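/- Let $\mathcal A$ be a unital $C^*$-algebra. A trace on $\mathcal A$ is a linear functional $\varphi$ with $\varphi(ab)=\varphi(ba)$ for all $a,b$; let $T(\mathcal A)$ be the space of bounded traces and $T(\mathcal A)_1^+$ the set of positive bounded traces of norm one. Assume that $T(\mathcal A)$ is finite dimensional and that $T(\mathcal A)_1^+$ has exactly $n$ extreme points, $\varphi_1,\dots,\varphi_n$ (they form a basis of $T(\mathcal A)$). A self-similar pair $(p,\Phi)$ consists of a projection $p\in M_k(\mathcal A)$ (for some $k$) such that the linear span of $\{a^*pb : a,b\in\mathcal A^k\}$ is dense in $\mathcal A$, and a $*$-isomorphism $\Phi$ from $\mathcal A$ onto $pM_k(\mathcal A)p$. It defines a bounded linear map $T_{(p,\Phi)}$ on $T(\mathcal A)$ by $T_{(p,\Phi)}(\varphi)=(\mathrm{Tr}_k\otimes\varphi)\circ\Phi$, with $\mathrm{Tr}_k$ the unnormalized trace. The fundamental group $F(\mathcal A)\subset M_n(\mathbb C)$ is the set of the matrices $B=(B_{ij})$ that represent such maps in the basis $\varphi_1,\dots,\varphi_n$, i.e. $T_{(p,\Phi)}(\varphi_j)=\sum_{i=1}^n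 B_{ij}\varphi_i$ for all $j$. Let $\varphi^*$ denote the additive map on $K_0(\mathcal A)$ with $\varphi^*([p]_0)=(\mathrm{Tr}_k\otimes\varphi)(p)$ for projections $p\in M_k(\mathcal A)$; it is real valued when $\varphi$ is positive. For $\sigma\in S_n$ let $U(\sigma)$ be the permutation matrix with $U(\sigma)_{ij}=1$ if $j=\sigma(i)$ and $0$ otherwise. Then for every $B\in F(\mathcal A)$ there exist a diagonal matrix $D$ with strictly positive real diagonal entries and a permutation $\sigma\in S_n$ such that $B=D\,U(\sigma)$ and $$D_{ii}\,\varphi_i^*(K_0(\mathcal A))=\varphi_{\sigma(i)}^*(K_0(\mathcal A))\qquad\text{for } i=1,\dots,n.$$ -/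

import Mathlib

open scoped Matrix ComplexOrder

noncomputable section

namespace TraceFundamentalGroup

universe u

/-! ### Bounded traces -/

/-- `T(A)`: the complex vector space of bounded traces on `A`, with the norm of the dual of `A`. -/
def boundedTraces (A : Type u) [CStarAlgebra A] : Submodule ℂ (StrongDual ℂ A) where
  carrier := {φ | ∀ a b : A, φ (a * b) = φ (b * a)}
  add_mem' := fun hφ hψ a b => by
    simp only [add_apply]
    rw [hφ a b, hψ a b]
  zero_mem' := fun a b => by simp
  smul_mem' := fun c φ hφ a b => by
    simp only [smul_apply]
    rw [hφ a b]

/-- `T(A)₁⁺`: the set of positive bounded traces of norm one. -/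
def normalizedTraces (A : Type u) [CStarAlgebra A] : Set (boundedTraces A) :=
  {φ | (∀ a : A, 0 ≤ (φ : StrongDual ℂ A) (star a * a)) ∧ ‖φ‖ = 1}

/-- `∂ₑT(A)₁⁺`: the set of extreme points of `T(A)₁⁺`. -/
def extremeTraces (A : Type u) [CStarAlgebra A] : Set (boundedTraces A) :=
  Set.extremePoints ℝ (normalizedTraces A)

theorem trace_symm {A : Type u} [CStarAlgebra A] (φ : boundedTraces A)
    {m n : Type*} [Fintype m] [Fintype n] (x : Matrix m n A) (y : Matrix n m A) :
    (φ : StrongDual ℂ A) (x * y).trace = (φ : StrongDual ℂ A) (y * x).trace := by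
  simp only [Matrix.trace, Matrix.diag_apply, Matrix.mul_apply, map_sum]
  rw [Finset.sum_comm]
  exact Finset.sum_congr rfl fun i _ => Finset.sum_congr rfl fun j _ => φ.2 _ _

/-! ### Self-similar pairs and the maps they induce on traces -/

/-- The corner `p M_k(A) p` of a projection `p`, as a `*`-algebra. -/
def corner {A : Type u} [CStarAlgebra A] {k : ℕ} (p : Matrix (Fin k) (Fin k) A)
    (hp : IsStarProjection p) : NonUnitalStarSubalgebra ℂ (Matrix (Fin k) (Fin k) A) where
  carrier := {x | p * x * p = x}
  add_mem' := fun {x y} (hx : p * x * p = x) (hy : p * y * p = y) => by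
    change p * (x + y) * p = x + y
    rw [mul_add, add_mul, hx, hy]
  zero_mem' := by simp
  mul_mem' := fun {x y} (hx : p * x * p = x) (hy : p * y * p = y) => by
    have hpp : p * p = p := hp.isIdempotentElem
    have h1 : p * x = x := by rw [← hx, ← mul_assoc, ← mul_assoc, hpp]
    have h2 : y * p = y := by rw [← hy, mul_assoc, hpp]
    change p * (x * y) * p = x * y
    rw [← mul_assoc, h1, mul_assoc, h2]
  smul_mem' := fun c x (hx : p * x * p = x) => by
    change p * (c • x) * p = c • x
    rw [mul_smul_comm, smul_mul_assoc, hx]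
  star_mem' := fun {x} (hx : p * x * p = x) => by
    have hs : star p = p := hp.isSelfAdjoint
    change p * star x * p = star x
    conv_rhs => rw [← hx]
    rw [star_mul, star_mul, hs, mul_assoc]

/-- A self-similar pair `(p, Φ)` of size `k`: a projection `p ∈ M_k(A)` that is full, in the sense
that the linear span of `{a* p b | a, b ∈ A^k}` is dense in `A`, and a `*`-isomorphism
`Φ : A ≃ p M_k(A) p`. -/
structure SelfSimilarPair (A : Type u) [CStarAlgebra A] (k : ℕ) where
  p : Matrix (Fin k) (Fin k) A
  isProj : IsStarProjection p
  full : Dense (Submodule.span ℂ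
    {x : A | ∃ a b : Fin k → A, x = star a ⬝ᵥ (p *ᵥ b)} : Set A)
  Φ : A ≃⋆ₐ[ℂ] corner p isProj

namespace SelfSimilarPair

variable {A : Type u} [CStarAlgebra A] {k : ℕ}

/-- `Φ` as a `*`-homomorphism into the C*-algebra `M_k(A)`. -/
def hom (s : SelfSimilarPair A k) : A →⋆ₙₐ[ℂ] CStarMatrix (Fin k) (Fin k) A where
  toFun a := CStarMatrix.ofMatrix (s.Φ a : Matrix (Fin k) (Fin k) A)
  map_smul' c a := by
    rw [map_smul]
    rfl
  map_zero' := by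
    rw [map_zero]
    rfl
  map_add' a b := by
    rw [map_add]
    rfl
  map_mul' a b := by
    rw [map_mul]
    rfl
  map_star' a := by
    rw [map_star]
    rfl

theorem norm_entry_le (s : SelfSimilarPair A k) (a : A) (i j : Fin k) :
    ‖(s.Φ a : Matrix (Fin k) (Fin k) A) i j‖ ≤ ‖a‖ := by
  let := CStarAlgebra.spectralOrder A
  have := CStarAlgebra.spectralOrderedRing A
  exact le_trans (CStarMatrix.norm_entry_le_norm (M := s.hom a) (i := i) (j := j))
    (NonUnitalStarAlgHom.norm_apply_le s.hom a)

/-- The bounded linear map `a ↦ ∑ i, Φ(a)ᵢᵢ` from `A` to `A`. -/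
def diagSum (s : SelfSimilarPair A k) : A →L[ℂ] A :=
  LinearMap.mkContinuous
    { toFun := fun a => Matrix.trace (s.Φ a : Matrix (Fin k) (Fin k) A)
      map_add' := fun a b => by
        rw [map_add]
        exact Matrix.trace_add _ _
      map_smul' := fun c a => by
        rw [map_smul]
        exact Matrix.trace_smul _ _ } k fun a => by
      change ‖∑ i, (s.Φ a : Matrix (Fin k) (Fin k) A) i i‖ ≤ k * ‖a‖
      refine (norm_sum_le _ _).trans ((Finset.sum_le_sum fun i _ => s.norm_entry_le a i i).trans ?_)
      simp

/-- `T_{(p,Φ)} : φ ↦ (Tr_k ⊗ φ) ∘ Φ`, as a bounded linear map on `T(A)`. -/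
def traceMap (s : SelfSimilarPair A k) : boundedTraces A →L[ℂ] boundedTraces A :=
  ContinuousLinearMap.codRestrict
    (((ContinuousLinearMap.compL ℂ A A ℂ).flip s.diagSum).comp (boundedTraces A).subtypeL)
    (boundedTraces A) fun φ a b => by
      change (φ : StrongDual ℂ A) (Matrix.trace (s.Φ (a * b) : Matrix (Fin k) (Fin k) A)) =
        (φ : StrongDual ℂ A) (Matrix.trace (s.Φ (b * a) : Matrix (Fin k) (Fin k) A))
      rw [map_mul, map_mul]
      exact trace_symm φ _ _

theorem traceMap_apply (s : SelfSimilarPair A k) (φ : boundedTraces A) (a : A) :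
    (s.traceMap φ : StrongDual ℂ A) a =
      ∑ i, (φ : StrongDual ℂ A) ((s.Φ a : Matrix (Fin k) (Fin k) A) i i) := by
  change (φ : StrongDual ℂ A) (Matrix.trace (s.Φ a : Matrix (Fin k) (Fin k) A)) = _
  simp [Matrix.trace]

end SelfSimilarPair

/-- `F^tr(A)`: the set of all maps `T_{(p,Φ)}`, for `(p,Φ)` a self-similar pair. -/
def traceFundamentalGroup (A : Type u) [CStarAlgebra A] :
    Set (boundedTraces A →L[ℂ] boundedTraces A) :=
  {T | ∃ (k : ℕ) (s : SelfSimilarPair A k), T = s.traceMap}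

/-- `F(A)` with respect to an enumeration `φ` of the extreme normalized traces: the matrices that
represent the elements of `F^tr(A)`, where `B` represents `T` when column `j` of `B` holds
coordinates of `T (φ j)`, that is, `T (φ j) = ∑ i, B i j • φ i`. -/
def fundamentalGroup {A : Type u} [CStarAlgebra A] {n : ℕ} (φ : Fin n → boundedTraces A) :
    Set (Matrix (Fin n) (Fin n) ℂ) :=
  {B | ∃ T ∈ traceFundamentalGroup A, ∀ j, T (φ j) = ∑ i, B i j • φ i}

/-! ### Projections in matrices over `A` and the group `K₀(A)` -/

section MurrayVonNeumann

variable {A : Type u} [CStarAlgebra A]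

/-- Murray-von Neumann equivalence of two square matrices, possibly of different sizes: there is
a rectangular matrix `v` with `v* v = p` and `v v* = q`. -/
def MvN {m n : Type} [Fintype m] [Fintype n] (p : Matrix m m A) (q : Matrix n n A) : Prop :=
  ∃ v : Matrix n m A, vᴴ * v = p ∧ v * vᴴ = q

theorem MvN.refl {m : Type} [Fintype m] {p : Matrix m m A} (hp : IsStarProjection p) :
    MvN p p := by
  have h1 : pᴴ = p := hp.isSelfAdjoint
  have h2 : p * p = p := hp.isIdempotentElem
  exact ⟨p, by rw [h1, h2], by rw [h1, h2]⟩

theorem MvN.symm {m n : Type} [Fintype m] [Fintype n] {p : Matrix m m A} {q : Matrix n n A}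
    (h : MvN p q) : MvN q p := by
  obtain ⟨v, h1, h2⟩ := h
  exact ⟨vᴴ, by rw [Matrix.conjTranspose_conjTranspose, h2],
    by rw [Matrix.conjTranspose_conjTranspose, h1]⟩

theorem MvN.trans {l m n : Type} [Fintype l] [Fintype m] [Fintype n] {p : Matrix l l A}
    {q : Matrix m m A} {r : Matrix n n A} (hp : IsStarProjection p) (hr : IsStarProjection r)
    (h : MvN p q) (h' : MvN q r) : MvN p r := by
  obtain ⟨v, rfl, hv⟩ := h
  obtain ⟨w, hw, rfl⟩ := h'
  have hp2 : vᴴ * v * (vᴴ * v) = vᴴ * v := hp.isIdempotentElem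
  have hr2 : w * wᴴ * (w * wᴴ) = w * wᴴ := hr.isIdempotentElem
  refine ⟨w * v, ?_, ?_⟩
  · calc (w * v)ᴴ * (w * v) = vᴴ * (wᴴ * w) * v := by
          simp only [Matrix.conjTranspose_mul, Matrix.mul_assoc]
      _ = vᴴ * v * (vᴴ * v) := by rw [hw, ← hv]; simp only [Matrix.mul_assoc]
      _ = _ := hp2
  · calc (w * v) * (w * v)ᴴ = w * (v * vᴴ) * wᴴ := by
          simp only [Matrix.conjTranspose_mul, Matrix.mul_assoc]
      _ = w * wᴴ * (w * wᴴ) := by rw [hv, ← hw]; simp only [Matrix.mul_assoc]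
      _ = _ := hr2

theorem isStarProjection_submatrix {m n : Type} [Fintype m] [Fintype n]
    {p : Matrix m m A} (hp : IsStarProjection p) (e : n ≃ m) :
    IsStarProjection (p.submatrix e e) := by
  have h1 : pᴴ = p := hp.isSelfAdjoint
  have h2 : p * p = p := hp.isIdempotentElem
  refine ⟨?_, ?_⟩
  · change p.submatrix e e * p.submatrix e e = _
    rw [Matrix.submatrix_mul_equiv, h2]
  · change (p.submatrix e e)ᴴ = _
    rw [Matrix.conjTranspose_submatrix, h1]

theorem MvN.submatrix {m n : Type} [Fintype m] [Fintype n]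
    {p : Matrix m m A} (hp : IsStarProjection p) (e : n ≃ m) :
    MvN p (p.submatrix e e) := by
  have h1 : pᴴ = p := hp.isSelfAdjoint
  have h2 : p * p = p := hp.isIdempotentElem
  refine ⟨p.submatrix e id, ?_, ?_⟩
  · rw [Matrix.conjTranspose_submatrix, Matrix.submatrix_mul_equiv, h1, h2]
    rfl
  · rw [Matrix.conjTranspose_submatrix, h1]
    have := Matrix.submatrix_mul_equiv p p (e : n → m) (Equiv.refl m) (e : n → m)
    rw [h2] at this
    exact this

/-- The block diagonal matrix `p ⊕ q`. -/
def blockSum {m n : Type} (p : Matrix m m A) (q : Matrix n n A) : Matrix (m ⊕ n) (m ⊕ n) A :=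
  Matrix.fromBlocks p 0 0 q

theorem isStarProjection_blockSum {m n : Type} [Fintype m] [Fintype n]
    {p : Matrix m m A} {q : Matrix n n A} (hp : IsStarProjection p) (hq : IsStarProjection q) :
    IsStarProjection (blockSum p q) := by
  have h1 : pᴴ = p := hp.isSelfAdjoint
  have h2 : p * p = p := hp.isIdempotentElem
  have h3 : qᴴ = q := hq.isSelfAdjoint
  have h4 : q * q = q := hq.isIdempotentElem
  refine ⟨?_, ?_⟩
  · change blockSum p q * blockSum p q = _
    simp [blockSum, Matrix.fromBlocks_multiply, h2, h4]
  · change (blockSum p q)ᴴ = _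
    simp [blockSum, Matrix.fromBlocks_conjTranspose, h1, h3]

theorem MvN.blockSum {m n m' n' : Type} [Fintype m] [Fintype n] [Fintype m'] [Fintype n']
    {p : Matrix m m A} {q : Matrix n n A} {p' : Matrix m' m' A} {q' : Matrix n' n' A}
    (h : MvN p p') (h' : MvN q q') : MvN (blockSum p q) (blockSum p' q') := by
  obtain ⟨v, rfl, rfl⟩ := h
  obtain ⟨w, rfl, rfl⟩ := h'
  refine ⟨Matrix.fromBlocks v 0 0 w, ?_, ?_⟩ <;>
    simp [TraceFundamentalGroup.blockSum, Matrix.fromBlocks_multiply,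
      Matrix.fromBlocks_conjTranspose]

end MurrayVonNeumann

/-- `P_∞(A)`: the projections in the matrix algebras `M_k(A)`, over all sizes `k`. -/
def Proj (A : Type u) [CStarAlgebra A] : Type u :=
  Σ k : ℕ, {p : Matrix (Fin k) (Fin k) A // IsStarProjection p}

namespace Proj

variable {A : Type u} [CStarAlgebra A]

instance setoid (A : Type u) [CStarAlgebra A] : Setoid (Proj A) where
  r p q := MvN p.2.1 q.2.1
  iseqv := ⟨fun p => MvN.refl p.2.2, fun h => h.symm, fun {p _ r} h h' => h.trans p.2.2 r.2.2 h'⟩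

/-- Direct sum of projections, `p ⊕ q = diag(p, q)`. -/
def directSum (p q : Proj A) : Proj A :=
  ⟨p.1 + q.1, (blockSum p.2.1 q.2.1).submatrix finSumFinEquiv.symm finSumFinEquiv.symm,
    isStarProjection_submatrix (isStarProjection_blockSum p.2.2 q.2.2) _⟩

theorem directSum_mvN (p q : Proj A) : MvN (blockSum p.2.1 q.2.1) (directSum p q).2.1 :=
  MvN.submatrix (isStarProjection_blockSum p.2.2 q.2.2) _

end Proj

/-- `V(A)`: Murray-von Neumann classes of projections in matrix algebras over `A`. -/
def MvNClasses (A : Type u) [CStarAlgebra A] : Type u := Quotient (Proj.setoid A)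

namespace MvNClasses

variable {A : Type u} [CStarAlgebra A]

/-- The class of a projection in `V(A)`. -/
def mk (p : Proj A) : MvNClasses A := Quotient.mk _ p

theorem sound {p q : Proj A} (h : MvN p.2.1 q.2.1) : mk p = mk q := Quotient.sound h

instance : Add (MvNClasses A) where
  add := Quotient.map₂ Proj.directSum fun p p' h q q' h' =>
    ((Proj.directSum_mvN p q).symm.trans (Proj.directSum p q).2.2
      (isStarProjection_blockSum p'.2.2 q'.2.2) (MvN.blockSum h h')).trans
        (Proj.directSum p q).2.2 (Proj.directSum p' q').2.2 (Proj.directSum_mvN p' q')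

instance : Zero (MvNClasses A) where
  zero := mk ⟨0, 0, IsStarProjection.zero _⟩

theorem mk_add_mk (p q : Proj A) : mk p + mk q = mk (Proj.directSum p q) := rfl

theorem zero_def : (0 : MvNClasses A) = mk ⟨0, 0, IsStarProjection.zero _⟩ := rfl

/-- To identify `mk p + mk q` it suffices to compare with `blockSum p q`. -/
theorem add_eq {p q r : Proj A} (h : MvN (blockSum p.2.1 q.2.1) r.2.1) :
    mk p + mk q = mk r :=
  sound ((Proj.directSum_mvN p q).symm.trans (Proj.directSum p q).2.2 r.2.2 h)

theorem add_comm' (x y : MvNClasses A) : x + y = y + x := by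
  induction x using Quotient.inductionOn with | _ p
  induction y using Quotient.inductionOn with | _ q
  refine add_eq (p := p) (q := q) (r := Proj.directSum q p) ?_
  have h := MvN.submatrix (isStarProjection_blockSum p.2.2 q.2.2) (Equiv.sumComm _ _)
  have e : (blockSum p.2.1 q.2.1).submatrix (Equiv.sumComm (Fin q.1) (Fin p.1))
      (Equiv.sumComm (Fin q.1) (Fin p.1)) = blockSum q.2.1 p.2.1 := by
    ext (i | i) (j | j) <;> rfl
  rw [e] at h
  exact h.trans (isStarProjection_blockSum p.2.2 q.2.2) (Proj.directSum q p).2.2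
    (Proj.directSum_mvN q p)

theorem zero_add' (x : MvNClasses A) : 0 + x = x := by
  induction x using Quotient.inductionOn with | _ q
  rw [zero_def]
  refine add_eq (q := q) (r := q) ?_
  have h := MvN.submatrix (isStarProjection_blockSum (IsStarProjection.zero (Matrix (Fin 0) (Fin 0) A))
    q.2.2) (Equiv.emptySum (Fin 0) (Fin q.1)).symm
  have e : (blockSum (0 : Matrix (Fin 0) (Fin 0) A) q.2.1).submatrix
      (Equiv.emptySum (Fin 0) (Fin q.1)).symm (Equiv.emptySum (Fin 0) (Fin q.1)).symm = q.2.1 := by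
    ext i j
    rfl
  rw [e] at h
  exact h

theorem add_assoc' (x y z : MvNClasses A) : x + y + z = x + (y + z) := by
  induction x using Quotient.inductionOn with | _ p
  induction y using Quotient.inductionOn with | _ q
  induction z using Quotient.inductionOn with | _ r
  refine add_eq (p := Proj.directSum p q) (q := r) (r := Proj.directSum p (Proj.directSum q r)) ?_
  have hL := isStarProjection_blockSum (Proj.directSum p q).2.2 r.2.2
  have hpq := isStarProjection_blockSum p.2.2 q.2.2
  have hqr := isStarProjection_blockSum q.2.2 r.2.2
  have h1 : MvN (blockSum (Proj.directSum p q).2.1 r.2.1)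
      (blockSum (blockSum p.2.1 q.2.1) r.2.1) :=
    MvN.blockSum (Proj.directSum_mvN p q).symm (MvN.refl r.2.2)
  have h2 := MvN.submatrix (isStarProjection_blockSum hpq r.2.2)
    (Equiv.sumAssoc (Fin p.1) (Fin q.1) (Fin r.1)).symm
  have e : (blockSum (blockSum p.2.1 q.2.1) r.2.1).submatrix
      (Equiv.sumAssoc (Fin p.1) (Fin q.1) (Fin r.1)).symm
      (Equiv.sumAssoc (Fin p.1) (Fin q.1) (Fin r.1)).symm =
      blockSum p.2.1 (blockSum q.2.1 r.2.1) := by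
    ext (i | i | i) (j | j | j) <;> rfl
  rw [e] at h2
  have h3 : MvN (blockSum p.2.1 (blockSum q.2.1 r.2.1))
      (blockSum p.2.1 (Proj.directSum q r).2.1) :=
    MvN.blockSum (MvN.refl p.2.2) (Proj.directSum_mvN q r)
  have h4 := Proj.directSum_mvN p (Proj.directSum q r)
  exact ((h1.trans hL (isStarProjection_blockSum p.2.2 hqr) h2).trans hL
    (isStarProjection_blockSum p.2.2 (Proj.directSum q r).2.2) h3).trans hL
    (Proj.directSum p (Proj.directSum q r)).2.2 h4

instance : AddCommMonoid (MvNClasses A) where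
  add_assoc := add_assoc'
  zero_add := zero_add'
  add_zero x := (add_comm' x 0).trans (zero_add' x)
  add_comm := add_comm'
  nsmul := nsmulRec

end MvNClasses

/-- `K₀(A)` of the unital C*-algebra `A`: the Grothendieck group of `V(A)`. -/
abbrev K0 (A : Type u) [CStarAlgebra A] : Type u := Algebra.GrothendieckAddGroup (MvNClasses A)

section Pairing

variable {A : Type u} [CStarAlgebra A]

/-- The additive map `V(A) → ℂ`, `[p] ↦ (Tr ⊗ φ)(p)`, induced by a bounded trace `φ`. -/
def traceOnClasses (φ : boundedTraces A) : MvNClasses A →+ ℂ where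
  toFun := Quotient.lift (fun p : Proj A => (φ : StrongDual ℂ A) p.2.1.trace) fun p q h => by
    obtain ⟨v, h1, h2⟩ := h
    rw [← h1, ← h2]
    exact trace_symm φ _ _
  map_zero' := by
    change (φ : StrongDual ℂ A) (Matrix.trace (0 : Matrix (Fin 0) (Fin 0) A)) = 0
    simp
  map_add' x y := by
    induction x using Quotient.inductionOn with | _ p
    induction y using Quotient.inductionOn with | _ q
    change (φ : StrongDual ℂ A) (Proj.directSum p q).2.1.trace =
      (φ : StrongDual ℂ A) p.2.1.trace + (φ : StrongDual ℂ A) q.2.1.trace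
    obtain ⟨v, h1, h2⟩ := Proj.directSum_mvN p q
    rw [← h2, trace_symm φ, h1, ← map_add]
    simp [blockSum, Matrix.trace]

/-- `φ^* : K₀(A) → ℂ`, `[p] - [q] ↦ (Tr ⊗ φ)(p) - (Tr ⊗ φ)(q)`. For a positive trace `φ` its
values are real. -/
def traceOnK0 (φ : boundedTraces A) : K0 A →+ ℂ :=
  Algebra.GrothendieckAddGroup.lift (traceOnClasses φ)

end Pairing

end TraceFundamentalGroup

end

/-! Let `T` be the map on `T(A)` induced by a self-similar pair. It is an order isomorphism of the
cone of positive traces, so it permutes the extreme rays: `T φ_j = c_j φ_{τ j}` with `c_j > 0`. Then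
`σ = τ⁻¹` and `d_i = c_{σ i}`.

Positivity of `T` is immediate. For the inverse, fullness of `p` yields columns `w_r = p w_r` with
`∑ w_r* w_r = 1`, and the trace property gives `φ(b) = ∑ (T φ)(Φ⁻¹(w_r b w_r*))`
(`apply_eq_sum_traceMap`). Hence `T` is injective and reflects positivity; finite dimension makes it
surjective.

Applying `Φ`, or `b ↦ (Φ⁻¹(w_r b w_u*))_{r,u}`, to each entry sends projection matrices to
projection matrices. The two constructions give the two inclusions between the ranges on `K₀`
(`image_range_traceOnK0`).

Reading off `B` requires linear independence of the `φ_i` (`eq_zero_of_sum_extremeTraces_eq_zero`).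
On the GNS space of `f = ∑ φ_i`, with cyclic vector `ξ`, each `φ_i` has a density `h_i`, and these
densities commute. For `i ≠ j` the product `h_i h_j` is the density of a trace below both `φ_i` and
`φ_j`; extremality forces it to vanish. So the vectors `h_i ξ` are nonzero and mutually orthogonal.
-/

namespace TraceFundamentalGroup

open scoped InnerProductSpace
open Filter Topology UniformSpace

/-! ### Density operators of dominated traces on the GNS space -/

section GNS

variable {A : Type*} [CStarAlgebra A] [PartialOrder A] [StarOrderedRing A]

/-- The canonical map from `A` to the GNS space of `f`. -/
noncomputable def gnsCoe (f : A →ₚ[ℂ] ℂ) (a : A) : f.GNS := (f.toPreGNS a : f.GNS)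

variable {f g g₁ g₂ : A →ₚ[ℂ] ℂ}

theorem inner_gnsCoe (a b : A) : ⟪gnsCoe f a, gnsCoe f b⟫_ℂ = f (star a * b) := by
  rw [gnsCoe, gnsCoe, Completion.inner_coe]
  rfl

theorem denseRange_gnsCoe : DenseRange (gnsCoe f) :=
  Completion.denseRange_coe (α := f.PreGNS)

theorem gns_eq_of_inner_gnsCoe {x y : f.GNS} (h : ∀ a, ⟪gnsCoe f a, x⟫_ℂ = ⟪gnsCoe f a, y⟫_ℂ) :
    x = y := by
  refine ext_inner_left ℂ fun v => ?_
  refine congrFun ((denseRange_gnsCoe (f := f)).equalizer (g := fun v => ⟪v, x⟫_ℂ)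
    (h := fun v => ⟪v, y⟫_ℂ) (by fun_prop) (by fun_prop) (funext h)) v

theorem gns_map_ext {S T : f.GNS →L[ℂ] f.GNS} (h : ∀ a, S (gnsCoe f a) = T (gnsCoe f a)) :
    S = T :=
  ContinuousLinearMap.ext fun v =>
    congrFun (denseRange_gnsCoe.equalizer S.continuous T.continuous (funext h)) v

theorem gnsStarAlgHom_gnsCoe (a b : A) :
    f.gnsStarAlgHom a (gnsCoe f b) = gnsCoe f (a * b) :=
  PositiveLinearMap.gnsNonUnitalStarAlgHom_apply_coe f

theorem inner_gnsStarAlgHom_left (a : A) (x y : f.GNS) :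
    ⟪f.gnsStarAlgHom a x, y⟫_ℂ = ⟪x, f.gnsStarAlgHom (star a) y⟫_ℂ := by
  rw [map_star, ContinuousLinearMap.star_eq_adjoint, ContinuousLinearMap.adjoint_inner_right]

/-- A positive functional dominated by `f` is represented by a positive contraction on the GNS
space of `f`. -/
theorem exists_density (hgf : ∀ a, g (star a * a) ≤ f (star a * a)) :
    ∃ h : f.GNS →L[ℂ] f.GNS, 0 ≤ h ∧ h ≤ 1 ∧
      ∀ a b, ⟪gnsCoe f a, h (gnsCoe f b)⟫_ℂ = g (star a * b) := by
  -- Domination makes the identity of `A` a contraction from the `f`-seminorm to the `g`-seminorm;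
  -- the density is `V* V` for its extension `V`.
  let V₀ : f.PreGNS →L[ℂ] g.PreGNS :=
    (g.toPreGNS.toLinearMap ∘ₗ f.ofPreGNS.toLinearMap).mkContinuous 1 fun x => by
      rw [one_mul]
      refine Real.sqrt_le_sqrt ?_
      exact (Complex.le_def.mp (hgf (f.ofPreGNS x))).1
  let V : f.GNS →L[ℂ] g.GNS := V₀.completion
  have hV : ∀ a, V (gnsCoe f a) = gnsCoe g a := fun a => by
    change V₀.completion (f.toPreGNS a : f.GNS) = _
    rw [ContinuousLinearMap.completion_apply_coe]
    rfl
  have hker : ∀ a b, ⟪gnsCoe f a, (V.adjoint ∘L V) (gnsCoe f b)⟫_ℂ = g (star a * b) :=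
    fun a b => by
      rw [ContinuousLinearMap.comp_apply, ContinuousLinearMap.adjoint_inner_right, hV, hV,
        inner_gnsCoe]
  have hpos : (V.adjoint ∘L V).IsPositive := ContinuousLinearMap.isPositive_adjoint_comp_self V
  refine ⟨V.adjoint ∘L V, (ContinuousLinearMap.nonneg_iff_isPositive _).mpr hpos, ?_, hker⟩
  rw [ContinuousLinearMap.le_def, ContinuousLinearMap.isPositive_iff_complex]
  intro x
  have hsa : IsSelfAdjoint (1 - V.adjoint ∘L V) := (IsSelfAdjoint.one _).sub hpos.isSelfAdjoint
  refine ⟨?_, ?_⟩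
  · have := hsa.isSymmetric.coe_re_inner_apply_self x
    exact this
  · refine denseRange_gnsCoe.induction_on (p := fun x =>
      0 ≤ RCLike.re ⟪(1 - V.adjoint ∘L V) x, x⟫_ℂ) x
      (isClosed_le continuous_const (by fun_prop)) fun a => ?_
    have hs := hsa.isSymmetric (gnsCoe f a) (gnsCoe f a)
    simp only [ContinuousLinearMap.coe_coe] at hs
    rw [hs, sub_apply, inner_sub_right, hker,
      one_apply_eq_self, inner_gnsCoe]
    exact (Complex.le_def.mp (sub_nonneg.mpr (hgf a))).1

/-- The trace property makes `a ↦ a*` isometric: it is the antiunitary involution of the GNS space.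
-/
theorem norm_gnsCoe_star (hf : ∀ a b, f (a * b) = f (b * a)) (a : A) :
    ‖gnsCoe f (star a)‖ = ‖gnsCoe f a‖ := by
  rw [← sq_eq_sq₀ (norm_nonneg _) (norm_nonneg _), ← Complex.ofReal_inj]
  push_cast
  have h := inner_self_eq_norm_sq_to_K (𝕜 := ℂ) (gnsCoe f a)
  have h' := inner_self_eq_norm_sq_to_K (𝕜 := ℂ) (gnsCoe f (star a))
  rw [inner_gnsCoe] at h h'
  rw [star_star, hf] at h'
  exact h'.symm.trans h

/-- Right multiplication on the GNS space of a trace. -/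
theorem exists_rightMul (hf : ∀ a b, f (a * b) = f (b * a)) (c : A) :
    ∃ R : f.GNS →L[ℂ] f.GNS, ∀ a, R (gnsCoe f a) = gnsCoe f (a * c) := by
  let R₀ : f.PreGNS →L[ℂ] f.PreGNS :=
    (f.toPreGNS.toLinearMap ∘ₗ LinearMap.mulRight ℂ c ∘ₗ f.ofPreGNS.toLinearMap).mkContinuous
      ‖f.gnsStarAlgHom (star c)‖ fun x => by
        have h1 : ∀ y : f.PreGNS, ‖y‖ = ‖gnsCoe f (f.ofPreGNS y)‖ := fun y =>
          (Completion.norm_coe y).symm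
        rw [h1, h1]
        change ‖gnsCoe f (f.ofPreGNS x * c)‖ ≤ _
        -- The involution turns right multiplication by `c` into left multiplication by `c*`, which
        -- is bounded.
        rw [← norm_gnsCoe_star hf, ← norm_gnsCoe_star hf (f.ofPreGNS x), star_mul,
          ← gnsStarAlgHom_gnsCoe]
        exact ContinuousLinearMap.le_opNorm _ _
  refine ⟨R₀.completion, fun a => ?_⟩
  change R₀.completion (f.toPreGNS a : f.GNS) = _
  rw [ContinuousLinearMap.completion_apply_coe]
  rfl

variable {h h₁ h₂ : f.GNS →L[ℂ] f.GNS}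

theorem density_commute_leftMul (hh : ∀ a b, ⟪gnsCoe f a, h (gnsCoe f b)⟫_ℂ = g (star a * b))
    (c : A) (x : f.GNS) : h (f.gnsStarAlgHom c x) = f.gnsStarAlgHom c (h x) := by
  refine congrArg (fun S : f.GNS →L[ℂ] f.GNS => S x) (gns_map_ext
    (S := h ∘L f.gnsStarAlgHom c) (T := f.gnsStarAlgHom c ∘L h) fun b => ?_)
  refine gns_eq_of_inner_gnsCoe fun a => ?_
  rw [ContinuousLinearMap.comp_apply, ContinuousLinearMap.comp_apply, gnsStarAlgHom_gnsCoe, hh]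
  conv_rhs => rw [← star_star c, ← inner_gnsStarAlgHom_left, gnsStarAlgHom_gnsCoe, hh]
  simp [mul_assoc]

theorem density_gnsCoe (hh : ∀ a b, ⟪gnsCoe f a, h (gnsCoe f b)⟫_ℂ = g (star a * b)) (c : A) :
    h (gnsCoe f c) = f.gnsStarAlgHom c (h (gnsCoe f 1)) := by
  rw [← density_commute_leftMul hh, gnsStarAlgHom_gnsCoe, mul_one]

theorem adjoint_rightMul (hf : ∀ a b, f (a * b) = f (b * a)) {c : A} {R R' : f.GNS →L[ℂ] f.GNS}
    (hR : ∀ a, R (gnsCoe f a) = gnsCoe f (a * c))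
    (hR' : ∀ a, R' (gnsCoe f a) = gnsCoe f (a * star c)) : R.adjoint = R' := by
  refine gns_map_ext fun b => gns_eq_of_inner_gnsCoe fun a => ?_
  rw [ContinuousLinearMap.adjoint_inner_right, hR, hR', inner_gnsCoe, inner_gnsCoe, star_mul,
    mul_assoc, hf, mul_assoc]

theorem density_commute_rightMul (hf : ∀ a b, f (a * b) = f (b * a))
    (hg : ∀ a b, g (a * b) = g (b * a))
    (hh : ∀ a b, ⟪gnsCoe f a, h (gnsCoe f b)⟫_ℂ = g (star a * b))
    {c : A} {R : f.GNS →L[ℂ] f.GNS} (hR : ∀ a, R (gnsCoe f a) = gnsCoe f (a * c)) (x : f.GNS) :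
    h (R x) = R (h x) := by
  obtain ⟨R', hR'⟩ := exists_rightMul hf (star c)
  refine congrArg (fun S : f.GNS →L[ℂ] f.GNS => S x) (gns_map_ext
    (S := h ∘L R) (T := R ∘L h) fun b => ?_)
  refine gns_eq_of_inner_gnsCoe fun a => ?_
  rw [ContinuousLinearMap.comp_apply, ContinuousLinearMap.comp_apply, hR, hh,
    ← ContinuousLinearMap.adjoint_inner_left, adjoint_rightMul hf hR hR', hR', hh, star_mul,
    star_star, mul_assoc c, hg c, mul_assoc]

/-- The density of a trace is fixed by the antiunitary involution of the GNS space. -/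
theorem norm_star_sub_density (hf : ∀ a b, f (a * b) = f (b * a))
    (hh : ∀ a b, ⟪gnsCoe f a, h (gnsCoe f b)⟫_ℂ = g (star a * b)) (a : A) :
    ‖gnsCoe f (star a) - h (gnsCoe f 1)‖ = ‖gnsCoe f a - h (gnsCoe f 1)‖ := by
  rw [← sq_eq_sq₀ (norm_nonneg _) (norm_nonneg _), norm_sub_sq (𝕜 := ℂ), norm_sub_sq (𝕜 := ℂ), hh,
    hh, norm_gnsCoe_star hf, mul_one, mul_one, map_star g (star a)]
  simp

/-- Both sides are limits of `g₁(c y_m) = g₁(y_m c)`, where `y_m ξ → h₂ ξ`. The second limit uses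
that `y_m* ξ → h₂ ξ` as well, since the involution fixes `h₂ ξ`. -/
theorem inner_density_symm (hf : ∀ a b, f (a * b) = f (b * a))
    (hg₁ : ∀ a b, g₁ (a * b) = g₁ (b * a)) (h₁s : IsSelfAdjoint h₁)
    (hh₁ : ∀ a b, ⟪gnsCoe f a, h₁ (gnsCoe f b)⟫_ℂ = g₁ (star a * b))
    (hh₂ : ∀ a b, ⟪gnsCoe f a, h₂ (gnsCoe f b)⟫_ℂ = g₂ (star a * b)) (c : A) :
    ⟪h₁ (gnsCoe f 1), h₂ (gnsCoe f c)⟫_ℂ = ⟪h₂ (gnsCoe f 1), h₁ (gnsCoe f c)⟫_ℂ := by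
  obtain ⟨v, hv, hlim⟩ := mem_closure_iff_seq_limit.mp
    (denseRange_gnsCoe (f := f) (h₂ (gnsCoe f 1)))
  choose y hy using hv
  obtain rfl : (fun m => gnsCoe f (y m)) = v := funext hy
  have hlim' : Tendsto (fun m => gnsCoe f (star (y m))) atTop (𝓝 (h₂ (gnsCoe f 1))) := by
    rw [tendsto_iff_norm_sub_tendsto_zero] at hlim ⊢
    simpa only [norm_star_sub_density hf hh₂] using hlim
  have hval : ∀ a b, ⟪h₁ (gnsCoe f a), gnsCoe f b⟫_ℂ = g₁ (star a * b) := fun a b => by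
    rw [← hh₁]
    exact h₁s.isSymmetric _ _
  have e1 : Tendsto (fun m => g₁ (c * y m)) atTop
      (𝓝 ⟪h₁ (gnsCoe f 1), h₂ (gnsCoe f c)⟫_ℂ) := by
    have : ∀ m, g₁ (c * y m) = ⟪h₁ (gnsCoe f 1), f.gnsStarAlgHom c (gnsCoe f (y m))⟫_ℂ :=
      fun m => by rw [gnsStarAlgHom_gnsCoe, hval, star_one, one_mul]
    simp only [this]
    rw [density_gnsCoe hh₂ c]
    exact tendsto_const_nhds.inner (((f.gnsStarAlgHom c).continuous.tendsto _).comp hlim)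
  have e2 : Tendsto (fun m => g₁ (c * y m)) atTop
      (𝓝 ⟪h₂ (gnsCoe f 1), h₁ (gnsCoe f c)⟫_ℂ) := by
    have : ∀ m, g₁ (c * y m) = ⟪gnsCoe f (star (y m)), h₁ (gnsCoe f c)⟫_ℂ :=
      fun m => by rw [hh₁, star_star, hg₁]
    simp only [this]
    exact hlim'.inner tendsto_const_nhds
  exact tendsto_nhds_unique e1 e2

/-- Since densities commute with left multiplication, `⟪a ξ, h₁ h₂ b ξ⟫ = ⟪h₁ ξ, h₂ (a* b) ξ⟫`,
which reduces the claim to `inner_density_symm`. -/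
theorem density_commute (hf : ∀ a b, f (a * b) = f (b * a))
    (hg₁ : ∀ a b, g₁ (a * b) = g₁ (b * a)) (h₁s : IsSelfAdjoint h₁) (h₂s : IsSelfAdjoint h₂)
    (hh₁ : ∀ a b, ⟪gnsCoe f a, h₁ (gnsCoe f b)⟫_ℂ = g₁ (star a * b))
    (hh₂ : ∀ a b, ⟪gnsCoe f a, h₂ (gnsCoe f b)⟫_ℂ = g₂ (star a * b)) : Commute h₁ h₂ := by
  refine gns_map_ext fun b => gns_eq_of_inner_gnsCoe fun a => ?_
  change ⟪gnsCoe f a, h₁ (h₂ (gnsCoe f b))⟫_ℂ = ⟪gnsCoe f a, h₂ (h₁ (gnsCoe f b))⟫_ℂ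
  have s1 := h₁s.isSymmetric (gnsCoe f a) (h₂ (gnsCoe f b))
  have s2 := h₂s.isSymmetric (gnsCoe f a) (h₁ (gnsCoe f b))
  simp only [ContinuousLinearMap.coe_coe] at s1 s2
  rw [← s1, ← s2, density_gnsCoe hh₁ a, density_gnsCoe hh₂ a, inner_gnsStarAlgHom_left,
    inner_gnsStarAlgHom_left, ← density_commute_leftMul hh₁, ← density_commute_leftMul hh₂,
    gnsStarAlgHom_gnsCoe]
  exact inner_density_symm hf hg₁ h₁s hh₁ hh₂ _

/-- The functional `a ↦ ⟪h₁ ξ, a h₂ ξ⟫` is a trace. -/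
theorem inner_density_trace (hf : ∀ a b, f (a * b) = f (b * a))
    (hg₁ : ∀ a b, g₁ (a * b) = g₁ (b * a)) (hg₂ : ∀ a b, g₂ (a * b) = g₂ (b * a))
    (hh₁ : ∀ a b, ⟪gnsCoe f a, h₁ (gnsCoe f b)⟫_ℂ = g₁ (star a * b))
    (hh₂ : ∀ a b, ⟪gnsCoe f a, h₂ (gnsCoe f b)⟫_ℂ = g₂ (star a * b)) (a b : A) :
    ⟪h₁ (gnsCoe f 1), h₂ (gnsCoe f (a * b))⟫_ℂ = ⟪h₁ (gnsCoe f 1), h₂ (gnsCoe f (b * a))⟫_ℂ := by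
  have move : ∀ c x, ⟪h₁ (gnsCoe f 1), f.gnsStarAlgHom c x⟫_ℂ = ⟪h₁ (gnsCoe f (star c)), x⟫_ℂ :=
    fun c x => by
      rw [density_gnsCoe hh₁ (star c), inner_gnsStarAlgHom_left, star_star]
  obtain ⟨R, hR⟩ := exists_rightMul hf b
  obtain ⟨R', hR'⟩ := exists_rightMul hf (star b)
  have hRb : h₂ (gnsCoe f b) = R (h₂ (gnsCoe f 1)) := by
    rw [← density_commute_rightMul hf hg₂ hh₂ hR, hR, one_mul]
  rw [← gnsStarAlgHom_gnsCoe, density_commute_leftMul hh₂, move, hRb,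
    ← ContinuousLinearMap.adjoint_inner_left, adjoint_rightMul hf hR hR',
    ← density_commute_rightMul hf hg₁ hh₁ hR', hR', density_gnsCoe hh₂ (b * a), move, star_mul]

end GNS

/-! ### Positive traces -/

section PositiveTraces

variable {A : Type*} [CStarAlgebra A]

/-- Positivity of a bounded trace. -/
def IsPositiveTrace (φ : boundedTraces A) : Prop :=
  ∀ a : A, 0 ≤ (φ : StrongDual ℂ A) (star a * a)

theorem trace_coe_add (φ ψ : boundedTraces A) (a : A) :
    ((φ + ψ : boundedTraces A) : StrongDual ℂ A) a
      = (φ : StrongDual ℂ A) a + (ψ : StrongDual ℂ A) a := rfl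

theorem trace_coe_sub (φ ψ : boundedTraces A) (a : A) :
    ((φ - ψ : boundedTraces A) : StrongDual ℂ A) a
      = (φ : StrongDual ℂ A) a - (ψ : StrongDual ℂ A) a := rfl

theorem trace_coe_smul (c : ℂ) (φ : boundedTraces A) (a : A) :
    ((c • φ : boundedTraces A) : StrongDual ℂ A) a = c * (φ : StrongDual ℂ A) a := rfl

theorem trace_coe_sum {ι : Type*} (s : Finset ι) (φ : ι → boundedTraces A) (a : A) :
    ((∑ i ∈ s, φ i : boundedTraces A) : StrongDual ℂ A) a
      = ∑ i ∈ s, (φ i : StrongDual ℂ A) a := by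
  classical
  induction s using Finset.induction_on with
  | empty => rfl
  | insert i s hi ih => rw [Finset.sum_insert hi, Finset.sum_insert hi, trace_coe_add, ih]

theorem trace_ext {φ ψ : boundedTraces A}
    (h : ∀ a, (φ : StrongDual ℂ A) a = (ψ : StrongDual ℂ A) a) : φ = ψ :=
  Subtype.ext (ContinuousLinearMap.ext h)

theorem trace_real_smul (c : ℝ) (φ : boundedTraces A) : c • φ = (c : ℂ) • φ :=
  RCLike.real_smul_eq_coe_smul (K := ℂ) c φ

theorem IsPositiveTrace.smul {φ : boundedTraces A} (hφ : IsPositiveTrace φ) {c : ℂ} (hc : 0 ≤ c) :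
    IsPositiveTrace (c • φ) := fun a => by
  rw [trace_coe_smul]
  exact mul_nonneg hc (hφ a)

/-- A positive bounded trace as a positive linear functional. -/
noncomputable def IsPositiveTrace.toPositive [PartialOrder A] [StarOrderedRing A]
    {φ : boundedTraces A} (hφ : IsPositiveTrace φ) : A →ₚ[ℂ] ℂ :=
  PositiveLinearMap.mk₀ (φ : StrongDual ℂ A).toLinearMap fun x hx => by
    obtain ⟨y, rfl⟩ := CStarAlgebra.nonneg_iff_eq_star_mul_self.mp hx
    exact hφ y

theorem IsPositiveTrace.toPositive_apply [PartialOrder A] [StarOrderedRing A]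
    {φ : boundedTraces A} (hφ : IsPositiveTrace φ) (a : A) :
    hφ.toPositive a = (φ : StrongDual ℂ A) a := rfl

theorem IsPositiveTrace.map_one_nonneg {φ : boundedTraces A} (hφ : IsPositiveTrace φ) :
    0 ≤ (φ : StrongDual ℂ A) 1 := by
  simpa using hφ 1

/-- In the GNS representation `φ(a) = ⟪ξ, a ξ⟫`, so `|φ(a)| ≤ ‖a‖ ‖ξ‖² = ‖a‖ φ(1)`. Norm one thus
becomes the affine condition `φ(1) = 1`. -/
theorem IsPositiveTrace.norm_eq {φ : boundedTraces A} (hφ : IsPositiveTrace φ) :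
    (φ : StrongDual ℂ A) 1 = (‖φ‖ : ℂ) := by
  let := CStarAlgebra.spectralOrder A
  have := CStarAlgebra.spectralOrderedRing A
  have h1 := hφ.map_one_nonneg
  have hn : ((‖(φ : StrongDual ℂ A) 1‖ : ℝ) : ℂ) = (φ : StrongDual ℂ A) 1 :=
    (Complex.eq_coe_norm_of_nonneg h1).symm
  rw [← hn]
  congr 1
  refine le_antisymm ?_ ?_
  · cases subsingleton_or_nontrivial A with
    | inl _ =>
      rw [Subsingleton.elim (1 : A) 0, map_zero, norm_zero]
      exact norm_nonneg (φ : StrongDual ℂ A)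
    | inr _ =>
      have := (φ : StrongDual ℂ A).le_opNorm 1
      rwa [CStarRing.norm_one, mul_one] at this
  · refine ContinuousLinearMap.opNorm_le_bound _ (norm_nonneg _) fun a => ?_
    have hcoe : ∀ a, (φ : StrongDual ℂ A) a = ⟪gnsCoe hφ.toPositive 1, gnsCoe hφ.toPositive a⟫_ℂ :=
      fun a => by rw [inner_gnsCoe, star_one, one_mul, hφ.toPositive_apply]
    have hξ : ‖(φ : StrongDual ℂ A) 1‖ = ‖gnsCoe hφ.toPositive 1‖ ^ 2 := by
      rw [hcoe, inner_self_eq_norm_sq_to_K]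
      simp
    have ha : ‖gnsCoe hφ.toPositive a‖ ≤ ‖a‖ * ‖gnsCoe hφ.toPositive 1‖ := by
      have := (hφ.toPositive.gnsStarAlgHom a).le_of_opNorm_le
        (NonUnitalStarAlgHom.norm_apply_le hφ.toPositive.gnsStarAlgHom a) (gnsCoe hφ.toPositive 1)
      rwa [gnsStarAlgHom_gnsCoe, mul_one] at this
    change ‖(φ : StrongDual ℂ A) a‖ ≤ _
    rw [hcoe a, hξ]
    refine (norm_inner_le_norm _ _).trans ?_
    nlinarith [norm_nonneg (gnsCoe hφ.toPositive 1)]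

theorem mem_normalizedTraces {φ : boundedTraces A} :
    φ ∈ normalizedTraces A ↔ IsPositiveTrace φ ∧ (φ : StrongDual ℂ A) 1 = 1 := by
  refine and_congr_right fun hφ => ?_
  rw [IsPositiveTrace.norm_eq (φ := φ) hφ]
  norm_cast

theorem IsPositiveTrace.eq_zero {φ : boundedTraces A} (hφ : IsPositiveTrace φ)
    (h : (φ : StrongDual ℂ A) 1 = 0) : φ = 0 := by
  rw [hφ.norm_eq] at h
  have h' : ‖(φ : StrongDual ℂ A)‖ = 0 := Complex.ofReal_eq_zero.mp h
  exact Subtype.ext (norm_eq_zero.mp h')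

/-- An extreme normalized trace spans an extreme ray of the cone of positive traces. -/
theorem eq_smul_of_add_eq_extreme {φ α β : boundedTraces A} (hφ : φ ∈ extremeTraces A)
    (hα : IsPositiveTrace α) (hβ : IsPositiveTrace β) (h : α + β = φ) :
    α = (α : StrongDual ℂ A) 1 • φ := by
  obtain ⟨hφn, hex⟩ := mem_extremePoints_iff_left.mp hφ
  have h1 : (α : StrongDual ℂ A) 1 + (β : StrongDual ℂ A) 1 = 1 := by
    rw [← trace_coe_add, h, (mem_normalizedTraces.mp hφn).2]
  by_cases hα0 : (α : StrongDual ℂ A) 1 = 0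
  · rw [hα0, zero_smul, hα.eq_zero hα0]
  by_cases hβ0 : (β : StrongDual ℂ A) 1 = 0
  · rw [hβ0, add_zero] at h1
    rw [h1, one_smul, ← h, hβ.eq_zero hβ0, add_zero]
  rw [hα.norm_eq] at hα0 h1 ⊢
  rw [hβ.norm_eq] at hβ0 h1
  have normalize : ∀ {γ : boundedTraces A}, IsPositiveTrace γ → (‖γ‖ : ℂ) ≠ 0 →
      (‖γ‖ : ℂ)⁻¹ • γ ∈ normalizedTraces A := fun {γ} hγ h0 => by
    refine mem_normalizedTraces.mpr ⟨hγ.smul ?_, ?_⟩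
    · rw [← Complex.ofReal_inv]
      exact_mod_cast inv_nonneg.mpr (norm_nonneg γ)
    · rw [trace_coe_smul, hγ.norm_eq, inv_mul_cancel₀ h0]
  -- `φ` is the convex combination of the normalized `α` and `β` with weights `‖α‖` and `‖β‖`.
  have key := hex _ (normalize hα hα0) _ (normalize hβ hβ0) ⟨‖α‖, ‖β‖, ?_, ?_, ?_, ?_⟩
  · rw [← key, smul_inv_smul₀ hα0]
  · exact (norm_nonneg α).lt_of_ne' (by exact_mod_cast hα0)
  · exact (norm_nonneg β).lt_of_ne' (by exact_mod_cast hβ0)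
  · exact_mod_cast h1
  · rw [trace_real_smul, trace_real_smul, smul_inv_smul₀ hα0, smul_inv_smul₀ hβ0, h]

/-- The vectors representing two different extreme traces are orthogonal. -/
theorem inner_density_eq_zero [PartialOrder A] [StarOrderedRing A] {f : A →ₚ[ℂ] ℂ}
    (hf : ∀ a b, f (a * b) = f (b * a)) {φ₁ φ₂ : boundedTraces A} (hφ₁ : φ₁ ∈ extremeTraces A)
    (hφ₂ : φ₂ ∈ extremeTraces A) (hne : φ₁ ≠ φ₂)
    {h₁ h₂ : f.GNS →L[ℂ] f.GNS} (h₁0 : 0 ≤ h₁) (h₁1 : h₁ ≤ 1) (h₂0 : 0 ≤ h₂) (h₂1 : h₂ ≤ 1)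
    (hh₁ : ∀ a b, ⟪gnsCoe f a, h₁ (gnsCoe f b)⟫_ℂ = (φ₁ : StrongDual ℂ A) (star a * b))
    (hh₂ : ∀ a b, ⟪gnsCoe f a, h₂ (gnsCoe f b)⟫_ℂ = (φ₂ : StrongDual ℂ A) (star a * b)) :
    ⟪h₁ (gnsCoe f 1), h₂ (gnsCoe f 1)⟫_ℂ = 0 := by
  have hp₁ := (mem_normalizedTraces.mp hφ₁.1).1
  have hp₂ := (mem_normalizedTraces.mp hφ₂.1).1
  have ht₁ : ∀ a b, hp₁.toPositive (a * b) = hp₁.toPositive (b * a) := φ₁.2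
  have ht₂ : ∀ a b, hp₂.toPositive (a * b) = hp₂.toPositive (b * a) := φ₂.2
  replace hh₁ : ∀ a b, ⟪gnsCoe f a, h₁ (gnsCoe f b)⟫_ℂ = hp₁.toPositive (star a * b) := hh₁
  replace hh₂ : ∀ a b, ⟪gnsCoe f a, h₂ (gnsCoe f b)⟫_ℂ = hp₂.toPositive (star a * b) := hh₂
  have hs₁ := h₁0.isSelfAdjoint
  have hs₂ := h₂0.isSelfAdjoint
  have hc : Commute h₁ h₂ := density_commute hf ht₁ hs₁ hs₂ hh₁ hh₂
  -- The trace with density `h₁ h₂`. As `h₁` and `h₂` are commuting positive contractions, `0 ≤ h₁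
  -- h₂ ≤ h₁, h₂`, so it is dominated by both `φ₁` and `φ₂`.
  let ω₀ : StrongDual ℂ A := LinearMap.mkContinuous
    { toFun := fun a => (⟪h₁ (gnsCoe f 1), f.gnsStarAlgHom a (h₂ (gnsCoe f 1))⟫_ℂ : ℂ)
      map_add' := fun a b => by rw [map_add, add_apply, inner_add_right]
      map_smul' := fun c a => by
        rw [map_smul, smul_apply, inner_smul_right]
        rfl }
    (‖h₁ (gnsCoe f 1)‖ * ‖h₂ (gnsCoe f 1)‖) fun a => by
      refine (norm_inner_le_norm (h₁ (gnsCoe f 1)) (f.gnsStarAlgHom a (h₂ (gnsCoe f 1)))).trans ?_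
      rw [mul_assoc, mul_comm ‖h₂ _‖]
      exact mul_le_mul_of_nonneg_left ((f.gnsStarAlgHom a).le_of_opNorm_le
        (NonUnitalStarAlgHom.norm_apply_le f.gnsStarAlgHom a) _) (norm_nonneg _)
  have hω₀ : ∀ a, ω₀ a = ⟪h₁ (gnsCoe f 1), h₂ (gnsCoe f a)⟫_ℂ := fun a => by
    rw [density_gnsCoe hh₂ a]
    rfl
  let ω : boundedTraces A := ⟨ω₀, fun a b => by
    rw [hω₀, hω₀]
    exact inner_density_trace hf ht₁ ht₂ hh₁ hh₂ a b⟩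
  have hω : ∀ a, (ω : StrongDual ℂ A) (star a * a) = ⟪gnsCoe f a, (h₁ * h₂) (gnsCoe f a)⟫_ℂ :=
    fun a => by
      have s1 := hs₁.isSymmetric (gnsCoe f a) (h₂ (gnsCoe f a))
      simp only [ContinuousLinearMap.coe_coe] at s1
      change ω₀ _ = ⟪gnsCoe f a, h₁ (h₂ (gnsCoe f a))⟫_ℂ
      rw [hω₀, ← gnsStarAlgHom_gnsCoe, density_commute_leftMul hh₂, ← inner_gnsStarAlgHom_left,
        ← density_commute_leftMul hh₁, gnsStarAlgHom_gnsCoe, mul_one, s1]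
  have nonneg : ∀ {S : f.GNS →L[ℂ] f.GNS}, 0 ≤ S → ∀ x, 0 ≤ ⟪x, S x⟫_ℂ := fun hS x =>
    ((ContinuousLinearMap.nonneg_iff_isPositive _).mp hS).inner_nonneg_right x
  have hωpos : IsPositiveTrace ω := fun a => by
    rw [hω]
    exact nonneg (hc.mul_nonneg h₁0 h₂0) _
  have hle₁ : IsPositiveTrace (φ₁ - ω) := fun a => by
    rw [trace_coe_sub, hω, ← hp₁.toPositive_apply, ← hh₁, ← inner_sub_right, ← sub_apply]
    have : h₁ - h₁ * h₂ = h₁ * (1 - h₂) := by rw [mul_sub, mul_one]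
    rw [this]
    exact nonneg (((Commute.one_right h₁).sub_right hc).mul_nonneg h₁0 (sub_nonneg.mpr h₂1)) _
  have hle₂ : IsPositiveTrace (φ₂ - ω) := fun a => by
    rw [trace_coe_sub, hω, ← hp₂.toPositive_apply, ← hh₂, ← inner_sub_right, ← sub_apply]
    have : h₂ - h₁ * h₂ = (1 - h₁) * h₂ := by rw [sub_mul, one_mul]
    rw [this]
    exact nonneg (((Commute.one_left h₂).sub_left hc).mul_nonneg (sub_nonneg.mpr h₁1) h₂0) _
  -- Extremality gives `ω = ω(1) φ₁ = ω(1) φ₂`, and `ω(1)` is the inner product in question.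
  have e1 := eq_smul_of_add_eq_extreme hφ₁ hωpos hle₁ (add_sub_cancel ω _)
  have e2 := eq_smul_of_add_eq_extreme hφ₂ hωpos hle₂ (add_sub_cancel ω _)
  by_contra h0
  rw [← hω₀] at h0
  exact hne (smul_right_injective _ h0 (e1.symm.trans e2))

/-- Finitely many extreme normalized traces are linearly independent. -/
theorem eq_zero_of_sum_extremeTraces_eq_zero {ι : Type*} [Fintype ι] {φ : ι → boundedTraces A}
    (hinj : Function.Injective φ) (hφ : ∀ i, φ i ∈ extremeTraces A) {c : ι → ℂ}
    (hc : ∀ a, ∑ i, c i * (φ i : StrongDual ℂ A) a = 0) (j : ι) : c j = 0 := by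
  let := CStarAlgebra.spectralOrder A
  have := CStarAlgebra.spectralOrderedRing A
  have hp : ∀ i, IsPositiveTrace (φ i) := fun i => (mem_normalizedTraces.mp (hφ i).1).1
  have hsum : IsPositiveTrace (∑ i, φ i) := fun a => by
    rw [trace_coe_sum]
    exact Finset.sum_nonneg fun i _ => hp i a
  have hf : ∀ a b, hsum.toPositive (a * b) = hsum.toPositive (b * a) := (∑ i, φ i).2
  have hdom : ∀ i a, (hp i).toPositive (star a * a) ≤ hsum.toPositive (star a * a) :=
    fun i a => by
      rw [hsum.toPositive_apply, trace_coe_sum]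
      exact Finset.single_le_sum (f := fun i => (φ i : StrongDual ℂ A) (star a * a))
        (fun i _ => hp i a) (Finset.mem_univ i)
  choose h h0 h1 hh using fun i => exists_density (hdom i)
  have hval : ∀ i a, ⟪gnsCoe hsum.toPositive a, h i (gnsCoe hsum.toPositive 1)⟫_ℂ
      = (φ i : StrongDual ℂ A) (star a) := fun i a => by
    rw [hh, mul_one, (hp i).toPositive_apply]
  have hz : ∑ i, c i • h i (gnsCoe hsum.toPositive 1) = 0 := by
    refine gns_eq_of_inner_gnsCoe fun a => ?_
    rw [inner_sum, inner_zero_right]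
    simp only [inner_smul_right, hval]
    exact hc (star a)
  have hj := congrArg (fun x => ⟪h j (gnsCoe hsum.toPositive 1), x⟫_ℂ) hz
  simp only [inner_sum, inner_zero_right, inner_smul_right] at hj
  rw [Finset.sum_eq_single j (fun i _ hij => by
    rw [inner_density_eq_zero hf (hφ j) (hφ i) (hinj.ne hij.symm) (h0 j) (h1 j) (h0 i) (h1 i)
      (hh j) (hh i), mul_zero]) (fun hn => absurd (Finset.mem_univ j) hn)] at hj
  -- `h_j ξ ≠ 0` because `⟪ξ, h_j ξ⟫ = φ_j(1) = 1`.
  refine (mul_eq_zero.mp hj).resolve_right fun hzero => ?_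
  have h2 := hval j 1
  rw [inner_self_eq_zero.mp hzero, inner_zero_right, star_one,
    (mem_normalizedTraces.mp (hφ j).1).2] at h2
  exact zero_ne_one h2

end PositiveTraces

/-! ### Full projections -/

section Full

variable {A : Type*} [CStarAlgebra A] {k : ℕ} {p : Matrix (Fin k) (Fin k) A}

theorem star_dotProduct_proj (hp : IsStarProjection p) (a b : Fin k → A) :
    star a ⬝ᵥ (p *ᵥ b) = ∑ i, star ((p *ᵥ a) i) * (p *ᵥ b) i := by
  have h1 : pᴴ = p := hp.isSelfAdjoint
  have h2 : p * p = p := hp.isIdempotentElem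
  change _ = star (p *ᵥ a) ⬝ᵥ (p *ᵥ b)
  rw [Matrix.star_mulVec, ← Matrix.dotProduct_mulVec, h1, Matrix.mulVec_mulVec, h2]

/-- An element of the span of `{a* p b}` is dominated by a sum of elements `x* p x`. -/
theorem exists_add_star_le [PartialOrder A] [StarOrderedRing A] (hp : IsStarProjection p) {s : A}
    (hs : s ∈ Submodule.span ℂ {x : A | ∃ a b : Fin k → A, x = star a ⬝ᵥ (p *ᵥ b)}) (c : ℂ) :
    ∃ (ι : Type) (_ : Fintype ι) (x : ι → Fin k → A),
      c • s + star (c • s) ≤ ∑ r, star (x r) ⬝ᵥ (p *ᵥ x r) := by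
  -- Letting `c` vary absorbs the scalar-multiple case.
  induction hs using Submodule.span_induction generalizing c with
  | mem s hs =>
    obtain ⟨a, b, rfl⟩ := hs
    -- With `b' = c • b`, the inequality is `(a - b')* p (a - b') ≥ 0` expanded.
    refine ⟨Bool, inferInstance, fun r => cond r a (c • b), ?_⟩
    have hb : c • (star a ⬝ᵥ (p *ᵥ b)) = star a ⬝ᵥ (p *ᵥ (c • b)) := by
      rw [Matrix.mulVec_smul, dotProduct_smul]
    rw [hb]
    set b' := c • b
    rw [Fintype.sum_bool, ← sub_nonneg]
    have key : (star a ⬝ᵥ (p *ᵥ a) + star b' ⬝ᵥ (p *ᵥ b'))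
        - (star a ⬝ᵥ (p *ᵥ b') + star (star a ⬝ᵥ (p *ᵥ b')))
        = ∑ i, star ((p *ᵥ a) i - (p *ᵥ b') i) * ((p *ᵥ a) i - (p *ᵥ b') i) := by
      simp only [star_dotProduct_proj hp, star_sum, star_mul, star_star, star_sub, sub_mul, mul_sub,
        Finset.sum_sub_distrib]
      abel
    exact key ▸ Finset.sum_nonneg fun i _ => star_mul_self_nonneg _
  | zero => exact ⟨Empty, inferInstance, Empty.elim, by simp⟩
  | add s t _ _ hs ht =>
    obtain ⟨ι, _, x, hx⟩ := hs c
    obtain ⟨κ, _, y, hy⟩ := ht c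
    refine ⟨ι ⊕ κ, inferInstance, Sum.elim x y, ?_⟩
    rw [Fintype.sum_sum_type, smul_add, star_add, add_add_add_comm]
    exact add_le_add hx hy
  | smul z s _ hs =>
    rw [smul_smul]
    exact hs (c * z)

/-- A full projection satisfies `∑ x_r* p x_r = 1` for suitable finitely many columns `x_r`. -/
theorem exists_sum_star_dotProduct_eq_one (hp : IsStarProjection p)
    (hfull : Dense (Submodule.span ℂ
      {x : A | ∃ a b : Fin k → A, x = star a ⬝ᵥ (p *ᵥ b)} : Set A)) :
    ∃ (ι : Type) (_ : Fintype ι) (x : ι → Fin k → A),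
      ∑ r, star (x r) ⬝ᵥ (p *ᵥ x r) = 1 := by
  let := CStarAlgebra.spectralOrder A
  have := CStarAlgebra.spectralOrderedRing A
  -- Distance below `1 / 2` gives `‖(1 - s) + (1 - s)*‖ ≤ 1`, hence `s + s* ≥ 1`.
  obtain ⟨s, hs, hdist⟩ := hfull.exists_dist_lt (1 : A) (ε := 1 / 2) (by norm_num)
  obtain ⟨ι, _, x, hx⟩ := exists_add_star_le hp hs 1
  set h := ∑ r, star (x r) ⬝ᵥ (p *ᵥ x r) with hh
  have h1 : (1 : A) ≤ h := by
    have hsa : IsSelfAdjoint ((1 - s) + star (1 - s)) := IsSelfAdjoint.add_star_self _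
    have hn : ‖(1 - s) + star (1 - s)‖ ≤ 1 := by
      refine (norm_add_le _ _).trans ?_
      rw [norm_star]
      rw [dist_eq_norm] at hdist
      linarith
    have hle : (1 - s) + star (1 - s) ≤ 1 := by
      refine hsa.le_algebraMap_norm_self.trans ?_
      simpa only [map_one] using algebraMap_mono A hn
    rw [one_smul] at hx
    refine le_trans ?_ hx
    rw [← sub_nonneg] at hle ⊢
    convert hle using 1
    rw [star_sub, star_one]
    abel
  have hpos : IsStrictlyPositive h :=
    (CStarAlgebra.isUnit_of_le (1 : A) h1).isStrictlyPositive (zero_le_one.trans h1)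
  -- Replacing `x_r` by `x_r d` changes the sum from `h` to `d h d = 1`.
  set d : A := h ^ (-(1 / 2) : ℝ)
  have hd : star d = d := (CFC.rpow_nonneg (a := h) (y := -(1 / 2))).isSelfAdjoint
  refine ⟨ι, inferInstance, fun r i => x r i * d, ?_⟩
  rw [← CFC.conjugate_rpow_neg_one_half h]
  change _ = d * h * d
  rw [hh, Finset.mul_sum, Finset.sum_mul]
  refine Finset.sum_congr rfl fun r _ => ?_
  have hm : ∀ i, (p *ᵥ fun i => x r i * d) i = (p *ᵥ x r) i * d := fun i => by
    simp only [Matrix.mulVec, dotProduct, Finset.sum_mul, mul_assoc]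
  simp only [star_dotProduct_proj hp, hm, star_mul, hd, Finset.mul_sum, Finset.sum_mul, mul_assoc]

end Full

/-! ### Transport of projections and traces along a self-similar pair -/

namespace SelfSimilarPair

variable {A : Type*} [CStarAlgebra A] {k : ℕ} (s : SelfSimilarPair A k)

theorem exists_column_isometry : ∃ (ι : Type) (_ : Fintype ι) (w : Matrix (Fin k) ι A),
    s.p * w = w ∧ ∑ r, ∑ i, star (w i r) * w i r = 1 := by
  obtain ⟨ι, _, x, hx⟩ := exists_sum_star_dotProduct_eq_one s.isProj s.full
  have h2 : s.p * s.p = s.p := s.isProj.isIdempotentElem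
  refine ⟨ι, inferInstance, s.p * (Matrix.of x)ᵀ, by rw [← Matrix.mul_assoc, h2], ?_⟩
  rw [← hx]
  exact Finset.sum_congr rfl fun r _ => (star_dotProduct_proj s.isProj _ _).symm

theorem map_star_mul_self (a : A) : (s.Φ (star a * a) : Matrix (Fin k) (Fin k) A)
    = (s.Φ a : Matrix (Fin k) (Fin k) A)ᴴ * (s.Φ a : Matrix (Fin k) (Fin k) A) := by
  rw [map_mul, map_star]
  rfl

theorem isPositiveTrace_traceMap {φ : boundedTraces A} (hφ : IsPositiveTrace φ) :
    IsPositiveTrace (s.traceMap φ) := fun a => by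
  rw [traceMap_apply, map_star_mul_self]
  refine Finset.sum_nonneg fun i _ => ?_
  rw [Matrix.mul_apply, map_sum]
  exact Finset.sum_nonneg fun j _ => hφ _

theorem eq_zero_of_map_eq_zero {a : A} (h : (s.Φ a : Matrix (Fin k) (Fin k) A) = 0) : a = 0 :=
  s.Φ.injective (by rw [map_zero]; exact Subtype.ext h)

/-- An element whose image is `y y*` for a column `y` is positive. -/
theorem nonneg_of_map_eq [PartialOrder A] [StarOrderedRing A] {c : A} (y : Fin k → A)
    (h : (s.Φ c : Matrix (Fin k) (Fin k) A) = Matrix.of fun i j => y i * star (y j)) : 0 ≤ c := by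
  have hc : IsSelfAdjoint c := by
    refine s.Φ.injective ?_
    change s.Φ (star c) = s.Φ c
    rw [map_star]
    refine Subtype.ext ?_
    change (s.Φ c : Matrix (Fin k) (Fin k) A)ᴴ = _
    rw [h]
    ext i j
    simp
  set n := c⁻
  have hn0 : 0 ≤ n := CFC.negPart_nonneg c
  have hns : star n = n := hn0.isSelfAdjoint
  set g := CFC.sqrt n
  have hg : star g = g := (CFC.sqrt_nonneg n).isSelfAdjoint
  have hgg : g * g = n := CFC.sqrt_mul_sqrt_self n
  have hdec : c⁺ - n = c := CFC.posPart_sub_negPart c hc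
  -- With `g = √n`, this is `n c n = -n³`. Under `Φ` it becomes a vanishing sum of two positive
  -- matrices, whose diagonal entries force `Φ(n g) = 0`; then `n² = n g g = 0`.
  have hcn : n * c * star n + (n * g) * star (n * g) = 0 := by
    rw [← hdec, mul_sub, CFC.negPart_mul_posPart, star_mul, hns, hg]
    rw [zero_sub, neg_mul, mul_assoc n g, ← mul_assoc g g, hgg, mul_assoc, neg_add_cancel]
  have hmap : ∀ i, (∑ l, (s.Φ n : Matrix (Fin k) (Fin k) A) i l * y l) *
      star (∑ l, (s.Φ n : Matrix (Fin k) (Fin k) A) i l * y l) +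
      ∑ j, (s.Φ (n * g) : Matrix (Fin k) (Fin k) A) i j *
        star ((s.Φ (n * g) : Matrix (Fin k) (Fin k) A) i j) = 0 := fun i => by
    have e := congrArg (fun a => (s.Φ a : Matrix (Fin k) (Fin k) A) i i) hcn
    simp only [map_add, map_zero, map_mul _ _ (star _), map_mul _ n c, map_star] at e
    change (((s.Φ n : Matrix (Fin k) (Fin k) A) * (s.Φ c : Matrix (Fin k) (Fin k) A) *
      (s.Φ n : Matrix (Fin k) (Fin k) A)ᴴ) + (s.Φ (n * g) : Matrix (Fin k) (Fin k) A) *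
      (s.Φ (n * g) : Matrix (Fin k) (Fin k) A)ᴴ) i i = 0 at e
    rw [h] at e
    rw [← e, Matrix.add_apply, Matrix.mul_apply, Matrix.mul_apply]
    simp only [Matrix.mul_apply, Matrix.of_apply, Matrix.conjTranspose_apply, star_sum, star_mul,
      Finset.sum_mul, Finset.mul_sum, mul_assoc]
  have hng : n * g = 0 := by
    refine s.eq_zero_of_map_eq_zero ?_
    ext i j
    have e1 := (add_eq_zero_iff_of_nonneg (mul_star_self_nonneg _)
      (Finset.sum_nonneg fun j _ => mul_star_self_nonneg _)).mp (hmap i)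
    have e2 := (Finset.sum_eq_zero_iff_of_nonneg fun j _ => mul_star_self_nonneg _).mp e1.2 j
      (Finset.mem_univ j)
    exact CStarRing.mul_star_self_eq_zero_iff _ |>.mp e2
  have hnn : n = 0 := by
    rw [← CStarRing.star_mul_self_eq_zero_iff, hns]
    nth_rewrite 2 [← hgg]
    rw [← mul_assoc, hng, zero_mul]
  rw [← hdec, hnn, sub_zero]
  exact CFC.posPart_nonneg c

section Columns

variable {ι : Type} {w : Matrix (Fin k) ι A}

/-- The additive map `b ↦ w_r b w_u*` into the corner, for columns `w_r, w_u` in the range of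
`p`. -/
def dyad (hw : s.p * w = w) (r u : ι) : A →+ corner s.p s.isProj where
  toFun b := ⟨Matrix.of fun i j => w i r * b * star (w j u), by
    have h1 : s.pᴴ = s.p := s.isProj.isSelfAdjoint
    have hw' : wᴴ * s.p = wᴴ := by
      conv_rhs => rw [← hw, Matrix.conjTranspose_mul, h1]
    have hl : s.p * (Matrix.of fun i j => w i r * b * star (w j u))
        = Matrix.of fun i j => w i r * b * star (w j u) := by
      ext i j
      have e := congrFun (congrFun hw i) r
      rw [Matrix.mul_apply] at e
      simp only [Matrix.mul_apply, Matrix.of_apply, ← mul_assoc, ← Finset.sum_mul, e]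
    have hr : (Matrix.of fun i j => w i r * b * star (w j u)) * s.p
        = Matrix.of fun i j => w i r * b * star (w j u) := by
      ext i j
      have e := congrFun (congrFun hw' u) j
      rw [Matrix.mul_apply] at e
      simp only [Matrix.conjTranspose_apply] at e
      simp only [Matrix.mul_apply, Matrix.of_apply, mul_assoc, ← Finset.mul_sum, e]
    change s.p * _ * s.p = _
    rw [hl, hr]⟩
  map_zero' := by
    refine Subtype.ext (Matrix.ext fun i j => ?_)
    simp
  map_add' a b := by
    refine Subtype.ext (Matrix.ext fun i j => ?_)
    simp [mul_add, add_mul]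

theorem dyad_apply (hw : s.p * w = w) (r u : ι) (b : A) (i j : Fin k) :
    (s.dyad hw r u b : Matrix (Fin k) (Fin k) A) i j = w i r * b * star (w j u) := rfl

theorem star_dyad (hw : s.p * w = w) (r u : ι) (b : A) :
    star (s.dyad hw r u b) = s.dyad hw u r (star b) := by
  refine Subtype.ext (Matrix.ext fun i j => ?_)
  change star ((s.dyad hw r u b : Matrix (Fin k) (Fin k) A) j i) = _
  rw [dyad_apply, dyad_apply, star_mul, star_mul, star_star, mul_assoc]

/-- The sum over `u` inserts `∑ w_u* w_u = 1` between `b` and `c`. This makes `b ↦ (w_r b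
w_u*)_{r,u}` multiplicative. -/
theorem sum_dyad_mul_dyad [Fintype ι] (hw : s.p * w = w) (hw1 : ∑ r, ∑ i, star (w i r) * w i r = 1)
    (r v : ι) (b c : A) : ∑ u, s.dyad hw r u b * s.dyad hw u v c = s.dyad hw r v (b * c) := by
  refine Subtype.ext (Matrix.ext fun i j => ?_)
  have e : ((∑ u, s.dyad hw r u b * s.dyad hw u v c : corner s.p s.isProj) :
      Matrix (Fin k) (Fin k) A) = ∑ u, (s.dyad hw r u b : Matrix (Fin k) (Fin k) A) *
        (s.dyad hw u v c : Matrix (Fin k) (Fin k) A) := by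
    rw [AddSubmonoidClass.coe_finsetSum]
    rfl
  rw [e, Matrix.sum_apply, dyad_apply]
  have e2 : w i r * (b * c) * star (w j v)
      = w i r * b * (∑ r, ∑ i, star (w i r) * w i r) * c * star (w j v) := by
    rw [hw1, mul_one, mul_assoc _ b c]
  rw [e2]
  simp only [Matrix.mul_apply, dyad_apply, Finset.mul_sum, Finset.sum_mul, mul_assoc]

/-- By the trace property `φ(w b w*) = φ(b w* w)`, and the `w* w` sum to `1`. This recovers `φ` from
its image. -/
theorem apply_eq_sum_traceMap [Fintype ι] (hw : s.p * w = w) (hw1 : ∑ r, ∑ i, star (w i r) * w i r = 1)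
    (φ : boundedTraces A) (b : A) : (φ : StrongDual ℂ A) b =
      ∑ r, (s.traceMap φ : StrongDual ℂ A) (s.Φ.symm (s.dyad hw r r b)) := by
  have e : ∀ r i, (φ : StrongDual ℂ A) (w i r * b * star (w i r))
      = (φ : StrongDual ℂ A) (b * (star (w i r) * w i r)) := fun r i => by
    rw [mul_assoc, φ.2, mul_assoc]
  simp only [traceMap_apply, StarAlgEquiv.apply_symm_apply, dyad_apply, e, ← map_sum,
    ← Finset.mul_sum]
  rw [hw1, mul_one]

end Columns

theorem traceMap_injective : Function.Injective s.traceMap := fun φ ψ h => by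
  obtain ⟨ι, _, w, hw, hw1⟩ := s.exists_column_isometry
  refine trace_ext fun a => ?_
  rw [s.apply_eq_sum_traceMap hw hw1, s.apply_eq_sum_traceMap hw hw1, h]

theorem isPositiveTrace_of_traceMap {φ : boundedTraces A} (h : IsPositiveTrace (s.traceMap φ)) :
    IsPositiveTrace φ := fun b => by
  let := CStarAlgebra.spectralOrder A
  have := CStarAlgebra.spectralOrderedRing A
  obtain ⟨ι, _, w, hw, hw1⟩ := s.exists_column_isometry
  rw [φ.2, s.apply_eq_sum_traceMap hw hw1]
  refine Finset.sum_nonneg fun r _ => ?_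
  have hc : 0 ≤ s.Φ.symm (s.dyad hw r r (b * star b)) := by
    refine s.nonneg_of_map_eq (fun i => w i r * b) (Matrix.ext fun i j => ?_)
    rw [StarAlgEquiv.apply_symm_apply, dyad_apply, Matrix.of_apply, star_mul]
    simp only [mul_assoc]
  obtain ⟨y, hy⟩ := CStarAlgebra.nonneg_iff_eq_star_mul_self.mp hc
  rw [hy]
  exact h y

end SelfSimilarPair

/-! ### The range of the pairing with `K₀` -/

section Range

variable {A : Type*} [CStarAlgebra A]

theorem exists_proj_trace_eq {J : Type} [Fintype J] {q : Matrix J J A} (hq : IsStarProjection q) :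
    ∃ Q : Proj A, Q.2.1.trace = q.trace := by
  let e : Fin (Fintype.card J) ≃ J := (Fintype.equivFin J).symm
  exact ⟨⟨_, q.submatrix e e, isStarProjection_submatrix hq e⟩, e.sum_comp fun j => q j j⟩

/-- Every element of `K₀` is a difference `[P] - [P']`, so matching values on projections suffices.
-/
theorem image_range_traceOnK0_subset {φ ψ : boundedTraces A} {c : ℂ}
    (h : ∀ P : Proj A, ∃ Q : Proj A,
      c * (φ : StrongDual ℂ A) P.2.1.trace = (ψ : StrongDual ℂ A) Q.2.1.trace) :
    (fun x => c * x) '' Set.range (traceOnK0 φ) ⊆ Set.range (traceOnK0 ψ) := by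
  have hof : ∀ (χ : boundedTraces A) (P : Proj A),
      traceOnK0 χ (Algebra.GrothendieckAddGroup.of (MvNClasses.mk P)) =
        (χ : StrongDual ℂ A) P.2.1.trace := fun χ P =>
    DFunLike.congr_fun (Algebra.GrothendieckAddGroup.lift.symm_apply_apply (traceOnClasses χ))
      (MvNClasses.mk P)
  rintro _ ⟨_, ⟨x, rfl⟩, rfl⟩
  change c * Algebra.GrothendieckAddGroup.lift (traceOnClasses φ) x ∈ _
  rw [Algebra.GrothendieckAddGroup.lift_apply]
  obtain ⟨P, hP⟩ := Quotient.exists_rep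
    ((AddLocalization.addMonoidOf (⊤ : AddSubmonoid (MvNClasses A))).sec x).1
  obtain ⟨P', hP'⟩ := Quotient.exists_rep
    (((AddLocalization.addMonoidOf (⊤ : AddSubmonoid (MvNClasses A))).sec x).2 : MvNClasses A)
  obtain ⟨Q, hQ⟩ := h P
  obtain ⟨Q', hQ'⟩ := h P'
  refine ⟨Algebra.GrothendieckAddGroup.of (MvNClasses.mk Q) -
    Algebra.GrothendieckAddGroup.of (MvNClasses.mk Q'), ?_⟩
  rw [map_sub, hof, hof, ← hQ, ← hQ', ← mul_sub, ← hP, ← hP']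
  rfl

end Range

namespace SelfSimilarPair

variable {A : Type*} [CStarAlgebra A] {k : ℕ} (s : SelfSimilarPair A k)

/-- The witness is `P` with `Φ` applied to each entry, flattened to a single matrix. -/
theorem exists_proj_traceMap_eq (φ : boundedTraces A) (P : Proj A) : ∃ Q : Proj A,
    (s.traceMap φ : StrongDual ℂ A) P.2.1.trace = (φ : StrongDual ℂ A) Q.2.1.trace := by
  obtain ⟨l, q, hq⟩ := P
  have h1 : qᴴ = q := hq.isSelfAdjoint
  have h2 : q * q = q := hq.isIdempotentElem
  let q' : Matrix (Fin l × Fin k) (Fin l × Fin k) A := Matrix.of fun x y =>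
    (s.Φ (q x.1 y.1) : Matrix (Fin k) (Fin k) A) x.2 y.2
  have hq' : IsStarProjection q' := by
    refine ⟨Matrix.ext fun x y => ?_, Matrix.ext fun x y => ?_⟩
    · have e := congrFun (congrFun h2 x.1) y.1
      rw [Matrix.mul_apply] at e
      change (q' * q') x y = (s.Φ (q x.1 y.1) : Matrix (Fin k) (Fin k) A) x.2 y.2
      rw [← e, map_sum, AddSubmonoidClass.coe_finsetSum, Matrix.sum_apply, Matrix.mul_apply,
        Fintype.sum_prod_type]
      refine Finset.sum_congr rfl fun t _ => ?_
      rw [map_mul]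
      change _ = ((s.Φ (q x.1 t) : Matrix (Fin k) (Fin k) A) *
        (s.Φ (q t y.1) : Matrix (Fin k) (Fin k) A)) x.2 y.2
      rw [Matrix.mul_apply]
      rfl
    · have e := congrFun (congrFun h1 x.1) y.1
      change star ((s.Φ (q y.1 x.1) : Matrix (Fin k) (Fin k) A) y.2 x.2)
        = (s.Φ (q x.1 y.1) : Matrix (Fin k) (Fin k) A) x.2 y.2
      rw [← e, Matrix.conjTranspose_apply, map_star]
      rfl
  obtain ⟨Q, hQ⟩ := exists_proj_trace_eq hq'
  refine ⟨Q, ?_⟩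
  rw [hQ, Matrix.trace, Matrix.trace, map_sum, map_sum, Fintype.sum_prod_type]
  exact Finset.sum_congr rfl fun t _ => s.traceMap_apply φ _

/-- The witness replaces each entry `b` of `P` by the block `(Φ⁻¹(w_r b w_u*))_{r,u}`;
`apply_eq_sum_traceMap` computes its trace. -/
theorem exists_proj_eq_traceMap (φ : boundedTraces A) (P : Proj A) : ∃ Q : Proj A,
    (φ : StrongDual ℂ A) P.2.1.trace = (s.traceMap φ : StrongDual ℂ A) Q.2.1.trace := by
  obtain ⟨l, q, hq⟩ := P
  have h1 : qᴴ = q := hq.isSelfAdjoint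
  have h2 : q * q = q := hq.isIdempotentElem
  obtain ⟨ι, _, w, hw, hw1⟩ := s.exists_column_isometry
  let q' : Matrix (Fin l × ι) (Fin l × ι) A := Matrix.of fun x y =>
    s.Φ.symm (s.dyad hw x.2 y.2 (q x.1 y.1))
  have hq' : IsStarProjection q' := by
    refine ⟨Matrix.ext fun x y => ?_, Matrix.ext fun x y => ?_⟩
    · have e := congrFun (congrFun h2 x.1) y.1
      rw [Matrix.mul_apply] at e
      change (q' * q') x y = s.Φ.symm (s.dyad hw x.2 y.2 (q x.1 y.1))
      rw [← e, map_sum, map_sum, Matrix.mul_apply, Fintype.sum_prod_type]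
      refine Finset.sum_congr rfl fun t _ => ?_
      rw [← s.sum_dyad_mul_dyad hw hw1, map_sum]
      exact Finset.sum_congr rfl fun u _ => (map_mul s.Φ.symm _ _).symm
    · have e := congrFun (congrFun h1 x.1) y.1
      change star (s.Φ.symm (s.dyad hw y.2 x.2 (q y.1 x.1)))
        = s.Φ.symm (s.dyad hw x.2 y.2 (q x.1 y.1))
      rw [← e, Matrix.conjTranspose_apply, ← map_star, star_dyad]
  obtain ⟨Q, hQ⟩ := exists_proj_trace_eq hq'
  refine ⟨Q, ?_⟩
  rw [hQ, Matrix.trace, Matrix.trace, map_sum, map_sum, Fintype.sum_prod_type]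
  exact Finset.sum_congr rfl fun t _ => s.apply_eq_sum_traceMap hw hw1 φ _

/-- If `T_{(p,Φ)} φ = c ψ` then `c ψ^*(K₀(A)) = φ^*(K₀(A))`. -/
theorem image_range_traceOnK0 {φ ψ : boundedTraces A} {c : ℂ} (hc : c ≠ 0)
    (h : s.traceMap φ = c • ψ) :
    (fun x => c * x) '' Set.range (traceOnK0 ψ) = Set.range (traceOnK0 φ) := by
  refine Set.Subset.antisymm (image_range_traceOnK0_subset fun P => ?_) fun x hx => ?_
  · rw [← trace_coe_smul, ← h]
    exact s.exists_proj_traceMap_eq φ P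
  · refine ⟨c⁻¹ * x, image_range_traceOnK0_subset (fun P => ?_) ⟨x, hx, rfl⟩,
      mul_inv_cancel_left₀ hc x⟩
    obtain ⟨Q, hQ⟩ := s.exists_proj_eq_traceMap φ P
    exact ⟨Q, by rw [hQ, h, trace_coe_smul, inv_mul_cancel_left₀ hc]⟩

/-! ### Permutation of the extreme rays -/

theorem traceMap_surjective [FiniteDimensional ℂ (boundedTraces A)] :
    Function.Surjective s.traceMap :=
  LinearMap.surjective_of_injective (K := ℂ) (V := boundedTraces A)
    (f := s.traceMap.toLinearMap) s.traceMap_injective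

/-- `T_{(p,Φ)}` maps an extreme normalized trace to a positive multiple of such a trace. -/
theorem exists_traceMap_extreme_eq [FiniteDimensional ℂ (boundedTraces A)] {φ : boundedTraces A}
    (hφ : φ ∈ extremeTraces A) :
    ∃ c : ℝ, 0 < c ∧ ∃ ψ ∈ extremeTraces A, s.traceMap φ = (c : ℂ) • ψ := by
  obtain ⟨hφp, hφ1⟩ := mem_normalizedTraces.mp hφ.1
  have hTp := s.isPositiveTrace_traceMap hφp
  set c : ℝ := ‖s.traceMap φ‖ with hc
  have hc1 : (s.traceMap φ : StrongDual ℂ A) 1 = (c : ℂ) := hTp.norm_eq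
  have hc0 : (c : ℂ) ≠ 0 := fun h0 => by
    have : φ = 0 := s.traceMap_injective (by rw [map_zero, hTp.eq_zero (hc1.trans h0)])
    rw [this] at hφ1
    exact zero_ne_one hφ1
  have hcpos : 0 < c := (norm_nonneg (s.traceMap φ : StrongDual ℂ A)).lt_of_ne'
    (by exact_mod_cast hc0)
  have hψ : s.traceMap φ = (c : ℂ) • (c : ℂ)⁻¹ • s.traceMap φ := (smul_inv_smul₀ hc0 _).symm
  have hcinv : (0 : ℂ) ≤ (c : ℂ)⁻¹ := by
    rw [← Complex.ofReal_inv]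
    exact_mod_cast inv_nonneg.mpr hcpos.le
  refine ⟨c, hcpos, (c : ℂ)⁻¹ • s.traceMap φ, mem_extremePoints_iff_left.mpr
    ⟨mem_normalizedTraces.mpr ⟨hTp.smul hcinv, ?_⟩, ?_⟩, hψ⟩
  · rw [trace_coe_smul, hc1, inv_mul_cancel₀ hc0]
  rintro x hx y hy ⟨a, b, ha, hb, -, hab⟩
  obtain ⟨hxp, hx1⟩ := mem_normalizedTraces.mp hx
  obtain ⟨hyp, -⟩ := mem_normalizedTraces.mp hy
  -- Pulling `T φ = c a x + c b y` back through `T` writes `φ` as a sum of positive traces `α + β`.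
  -- Then `α` lies on the ray of `φ`, so `x` lies on the ray of `T φ`.
  obtain ⟨α, hα⟩ := s.traceMap_surjective (((c * a : ℝ) : ℂ) • x)
  obtain ⟨β, hβ⟩ := s.traceMap_surjective (((c * b : ℝ) : ℂ) • y)
  have hαp : IsPositiveTrace α := s.isPositiveTrace_of_traceMap
    (hα ▸ hxp.smul (by exact_mod_cast (mul_pos hcpos ha).le))
  have hβp : IsPositiveTrace β := s.isPositiveTrace_of_traceMap
    (hβ ▸ hyp.smul (by exact_mod_cast (mul_pos hcpos hb).le))
  have hsum : α + β = φ := s.traceMap_injective (by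
    rw [map_add, hα, hβ, hψ, ← hab, trace_real_smul, trace_real_smul, smul_add, smul_smul,
      smul_smul]
    push_cast
    rfl)
  have hray := congrArg s.traceMap (eq_smul_of_add_eq_extreme hφ hαp hβp hsum)
  rw [map_smul, hα] at hray
  set t := (α : StrongDual ℂ A) 1
  have hval := congrArg (fun χ : boundedTraces A => (χ : StrongDual ℂ A) 1) hray
  simp only [trace_coe_smul, hx1, hc1, mul_one] at hval
  have hca : ((c * a : ℝ) : ℂ) ≠ 0 := by exact_mod_cast (mul_pos hcpos ha).ne'
  have ht : t = a := mul_right_cancel₀ hc0 (by rw [← hval]; push_cast; ring)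
  have ha0 : (a : ℂ) ≠ 0 := by exact_mod_cast ha.ne'
  refine smul_right_injective _ hca ?_
  change ((c * a : ℝ) : ℂ) • x = ((c * a : ℝ) : ℂ) • (c : ℂ)⁻¹ • s.traceMap φ
  rw [hray, ht, smul_smul]
  congr 1
  push_cast
  field_simp

end SelfSimilarPair

end TraceFundamentalGroup

theorem mainTheorem1 {A : Type*} [CStarAlgebra A]
    [FiniteDimensional ℂ (TraceFundamentalGroup.boundedTraces A)]
    (n : ℕ) (φ : Fin n → TraceFundamentalGroup.boundedTraces A)
    (hφ_inj : Function.Injective φ)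
    (hφ_range : Set.range φ = TraceFundamentalGroup.extremeTraces A)
    (B : Matrix (Fin n) (Fin n) ℂ)
    (hB : B ∈ TraceFundamentalGroup.fundamentalGroup φ) :
    ∃ (d : Fin n → ℝ) (σ : Equiv.Perm (Fin n)),
      (∀ i, 0 < d i) ∧
      B = Matrix.diagonal (fun i => (d i : ℂ)) * σ.permMatrix ℂ ∧
      ∀ i, (fun x : ℂ => (d i : ℂ) * x) '' Set.range (TraceFundamentalGroup.traceOnK0 (φ i)) =
        Set.range (TraceFundamentalGroup.traceOnK0 (φ (σ i))) := by
  open TraceFundamentalGroup in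
  obtain ⟨_, ⟨k, s, rfl⟩, hT⟩ := hB
  have hext : ∀ j, φ j ∈ extremeTraces A := fun j => hφ_range ▸ Set.mem_range_self j
  have himage : ∀ j, ∃ c : ℝ, 0 < c ∧ ∃ i, s.traceMap (φ j) = (c : ℂ) • φ i := fun j => by
    obtain ⟨c, hc, ψ, hψ, h⟩ := s.exists_traceMap_extreme_eq (hext j)
    rw [← hφ_range] at hψ
    obtain ⟨i, rfl⟩ := hψ
    exact ⟨c, hc, i, h⟩
  choose c hc τ hτ using himage
  have hc0 : ∀ j, (c j : ℂ) ≠ 0 := fun j => by exact_mod_cast (hc j).ne'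
  have hτ_inj : Function.Injective τ := fun j j' h => hφ_inj <| by
    -- Both sides map to `c_j c_{j'} φ_{τ j}`; evaluating at `1` then gives `c_{j'} = c_j`.
    have e : (c j') • φ j = (c j) • φ j' := s.traceMap_injective (by
      rw [trace_real_smul, trace_real_smul, map_smul, map_smul, hτ, hτ, h, smul_comm])
    rw [trace_real_smul, trace_real_smul] at e
    have e1 := congrArg (fun χ : boundedTraces A => (χ : StrongDual ℂ A) 1) e
    simp only [trace_coe_smul, (mem_normalizedTraces.mp (hext _).1).2, mul_one] at e1
    rw [e1] at e
    exact smul_right_injective _ (hc0 j) e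
  let τe : Equiv.Perm (Fin n) := Equiv.ofBijective τ (Finite.injective_iff_bijective.mp hτ_inj)
  have hσ : ∀ i, τ (τe.symm i) = i := τe.apply_symm_apply
  -- `B` has `c_j` at position `(τ j, j)`, while `U(σ)` has its ones at `(i, σ i)`; hence `σ = τ⁻¹`.
  refine ⟨fun i => c (τe.symm i), τe.symm, fun i => hc _, ?_, fun i => ?_⟩
  · ext i j
    -- Two expansions of `T φ_j` in the independent family `φ` are compared.
    have hzero := eq_zero_of_sum_extremeTraces_eq_zero hφ_inj hext
      (c := fun i => B i j - if i = τ j then (c j : ℂ) else 0) (fun a => ?_) i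
    · rw [sub_eq_zero.mp hzero, Matrix.diagonal_mul, Equiv.Perm.permMatrix,
        PEquiv.toMatrix_apply]
      have hiff : i = τ j ↔ τe.symm i = j := τe.symm_apply_eq.symm
      by_cases hij : i = τ j
      · have hj := hiff.mp hij
        rw [if_pos hij]
        simp [hj]
      · have hj : τe.symm i ≠ j := fun h => hij (hiff.mpr h)
        rw [if_neg hij]
        simp [hj]
    · have e := congrArg (fun χ : boundedTraces A => (χ : StrongDual ℂ A) a)
        ((hT j).symm.trans (hτ j))
      simp only [trace_coe_sum, trace_coe_smul] at e
      simp only [sub_mul, Finset.sum_sub_distrib, e, ite_mul, zero_mul, Finset.sum_ite_eq',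
        Finset.mem_univ, if_true, sub_self]
  · refine s.image_range_traceOnK0 (hc0 _) ?_
    rw [hτ, hσ]
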